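/- Let $n\ge 0$ and let $\mathfrak S_n$ be the set of permutations $\sigma=\sigma_1\sigma_2\cdots\sigma_n$ of $[n]=\{1,\dots,n\}$, where $\sigma_i=\sigma(i)$. For $\sigma\in\mathfrak S_n$ define the following subsets of $[n]$: $$\mathrm{Lmip}(\sigma)=\{i:\sigma_i<\sigma_j\ \text{for all } j<i\},\qquad \mathrm{Lmap}(\sigma)=\{i:\sigma_i>\sigma_j\ \text{for all } j<i\},$$ $$\mathrm{Rmip}(\sigma)=\{i:\sigma_i<\sigma_j\ \text{for all } j>i\},\qquad \mathrm{Rmap}(\sigma)=\{i:\sigma_i>\sigma_j\ \text{for all } j>i\},$$ and let $\mathrm{Lmil}(\sigma),\mathrm{Lmal}(\sigma),\mathrm{Rmil}(\sigma),\mathrm{Rmal}(\sigma)$ be the sets of letters $\sigma_i$ with $i$ in $\mathrm{Lmip}(\sigma),\mathrm{Lmap}(\sigma),\mathrm{Rmip}(\sigma),\mathrm{Rmap}(\sigma)$, respectively. Let $\mathrm{Cyc}(\sigma)$ be the set of the smallest elements of the cycles of $\sigma$ (fixed points being cycles of length one). For $i\in[n]$ let $b_i=\sigma^{-k_i}(i)$,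 where $k_i\ge 1$ is the smallest integer with $\sigma^{-k_i}(i)\le i$, and let $\mathrm{Lmic}_1(\sigma)=\{i: b_i=1\}$. For a set-valued statistic $\mathrm{Stat}$ let $\mathrm{Stat}^d(\sigma)=\{n+1-i: i\in \mathrm{Stat}(\sigma)\}$. Two pairs $(S,T)$ and $(S',T')$ of set-valued statistics are jointly equidistributed over $\mathfrak S_n$ if, for all $A,B\subseteq[n]$, $$\#\{\sigma\in\mathfrak S_n: S(\sigma)=A,\ T(\sigma)=B\}=\#\{\sigma\in\mathfrak S_n: S'(\sigma)=A,\ T'(\sigma)=B\},$$ and $(S,T)$ is symmetric if $(S,T)$ and $(T,S)$ are jointly equidistributed. Then, in each of the following two families, every pair is symmetric and any two pairs are jointly equidistributed over $\mathfrak S_n$: 1. $(\mathrm{Rmil},\mathrm{Lmap})$, $(\mathrm{Rmip}^d,\mathrm{Lmal}^d)$, $(\mathrm{Rmal}^d,\mathrm{Lmip})$, $(\mathrm{Rmap}^d,\mathrm{Lmil})$, $(\mathrm{Cyc},\mathrm{Rmil})$, $(\mathrm{Cyc},\mathrm{Lmap})$; 2. $(\mathrm{Rmil},\mathrm{Lmil})$,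 $(\mathrm{Lmap},\mathrm{Lmip})$, $(\mathrm{Rmip}^d,\mathrm{Rmap}^d)$, $(\mathrm{Rmal}^d,\mathrm{Lmal}^d)$, $(\mathrm{Cyc},\mathrm{Lmic}_1)$. -/

import Mathlib

/-! The ordered set `[n] = {1 < 2 < ⋯ < n}` is modelled by `Fin n`, the element `i : Fin n` standing
for the number `i + 1`.  A permutation `σ = σ₁ σ₂ ⋯ σₙ` of `[n]` is `σ : Equiv.Perm (Fin n)`, its
`i`-th letter being `σ i`. -/

namespace PermStat

/-- A set-valued statistic on the symmetric group of `[n]`. -/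
abbrev SetStat (n : ℕ) : Type := Equiv.Perm (Fin n) → Finset (Fin n)

variable {n : ℕ}

/-- Left-to-right minimum places. -/
def Lmip : SetStat n := fun σ => Finset.univ.filter fun i => ∀ j, j < i → σ i < σ j

/-- Left-to-right minimum letters. -/
def Lmil : SetStat n := fun σ => (Finset.univ.filter fun i => ∀ j, j < i → σ i < σ j).image σ

/-- Left-to-right maximum places. -/
def Lmap : SetStat n := fun σ => Finset.univ.filter fun i => ∀ j, j < i → σ j < σ i

/-- Left-to-right maximum letters. -/
def Lmal : SetStat n := fun σ => (Finset.univ.filter fun i => ∀ j, j < i → σ j < σ i).image σ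

/-- Right-to-left minimum places. -/
def Rmip : SetStat n := fun σ => Finset.univ.filter fun i => ∀ j, i < j → σ i < σ j

/-- Right-to-left minimum letters. -/
def Rmil : SetStat n := fun σ => (Finset.univ.filter fun i => ∀ j, i < j → σ i < σ j).image σ

/-- Right-to-left maximum places. -/
def Rmap : SetStat n := fun σ => Finset.univ.filter fun i => ∀ j, i < j → σ j < σ i

/-- Right-to-left maximum letters. -/
def Rmal : SetStat n := fun σ => (Finset.univ.filter fun i => ∀ j, i < j → σ j < σ i).image σ

/-- The cycle set: the smallest elements of the cycles of `σ`, fixed points being cycles of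
length one. -/
def Cyc : SetStat n := fun σ => Finset.univ.filter fun i => ∀ j, σ.SameCycle i j → i ≤ j

theorem exists_back_le (σ : Equiv.Perm (Fin n)) (i : Fin n) :
    ∃ k : ℕ, 1 ≤ k ∧ (σ⁻¹ ^ k) i ≤ i :=
  ⟨orderOf σ⁻¹, orderOf_pos _, by rw [pow_orderOf_eq_one]; exact le_refl i⟩

/-- The `i`-th entry `σ^{-k}(i)` of the B-code of `σ`, where `k ≥ 1` is the smallest integer such
that `σ^{-k}(i) ≤ i`. -/
def bCode (σ : Equiv.Perm (Fin n)) (i : Fin n) : Fin n :=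
  (σ⁻¹ ^ Nat.find (exists_back_le σ i)) i

/-- The positions at which the B-code of `σ` has its entry equal to the smallest element of `[n]`
(the number `1` of `[n]`, that is `0` in `Fin n`). -/
def Lmic₁ : SetStat n := fun σ => Finset.univ.filter fun i => (bCode σ i : ℕ) = 0

/-- The dual statistic: every `i` in the value is replaced by `n + 1 - i` (`Fin.rev` in `Fin n`). -/
def dual (S : SetStat n) : SetStat n := fun σ => (S σ).image Fin.rev

/-- The number of permutations at which the pair `p` of statistics takes the value `(A, B)`. -/
def jointCount (p : SetStat n × SetStat n) (A B : Finset (Fin n)) : ℕ :=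
  (Finset.univ.filter fun σ : Equiv.Perm (Fin n) => p.1 σ = A ∧ p.2 σ = B).card

/-- The two pairs of statistics have the same joint distribution. -/
def Equidistributed (p q : SetStat n × SetStat n) : Prop :=
  ∀ A B : Finset (Fin n), jointCount p A B = jointCount q A B

/-- The joint distribution of the pair is symmetric: `(S, T)` and `(T, S)` have the same joint
distribution. -/
def IsSymmetric (p : SetStat n × SetStat n) : Prop := Equidistributed p p.swap

/-- Each pair in the list has a symmetric joint distribution, and any two pairs in the list have the
same joint distribution. -/
def SymmetricAndEquidistributed (L : List (SetStat n × SetStat n)) : Prop :=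
  (∀ p ∈ L, IsSymmetric p) ∧ ∀ p ∈ L, ∀ q ∈ L, Equidistributed p q

end PermStat

open PermStat

namespace PermStat

open Equiv

variable {n : ℕ}

/-! ### Joint equidistribution -/

/-! Inversion, reversal and complementation are symmetries of the permutation diagram. They permute
the eight record statistics up to duality, so they link all the pairs without cycle statistics
inside each family. They also give the symmetry of (`Rmil`, `Lmap`) by inversion and of (`Lmap`,
`Lmip`) by complementation.

For the cycle statistics, a permutation of `[n + 1]` is encoded by the image `l` of `n + 1` and a
permutation of `[n]`, in two ways: `insertLetter` keeps the relative order of the other letters,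
`insertCycle` splices `n + 1` into a cycle. Both change only letters that are at least `l`, so
`Rmil` obeys one recursion for both (`Rmil_eq_truncateAt`). `Cyc` along `insertCycle` and `Lmap`
along `insertLetter` gain `n + 1` exactly when `l = n + 1`; `Lmic₁` of the inverse and `Lmip` gain
it exactly when `l = 1`. Matching the two codes (`exists_equiv_of_recursion`) carries one pair of
statistics to the other. -/

theorem equidistributed_of_equiv {p q : SetStat n × SetStat n} (e : Perm (Fin n) ≃ Perm (Fin n))
    (h₁ : ∀ σ, q.1 (e σ) = p.1 σ) (h₂ : ∀ σ, q.2 (e σ) = p.2 σ) : Equidistributed p q := by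
  intro A B
  unfold jointCount
  refine Finset.card_equiv e fun σ => ?_
  simp [h₁, h₂]

theorem Equidistributed.symm {p q : SetStat n × SetStat n} (h : Equidistributed p q) :
    Equidistributed q p := fun A B => (h A B).symm

theorem Equidistributed.trans {p q r : SetStat n × SetStat n} (h : Equidistributed p q)
    (h' : Equidistributed q r) : Equidistributed p r := fun A B => (h A B).trans (h' A B)

theorem Equidistributed.swap {p q : SetStat n × SetStat n} (h : Equidistributed p q) :
    Equidistributed p.swap q.swap := by
  intro A B
  simpa [jointCount, and_comm] using h B A

theorem SymmetricAndEquidistributed.of_forall {L : List (SetStat n × SetStat n)}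
    (p : SetStat n × SetStat n) (hp : IsSymmetric p) (h : ∀ q ∈ L, Equidistributed q p) :
    SymmetricAndEquidistributed L :=
  ⟨fun q hq => ((h q hq).trans hp).trans (h q hq).swap.symm,
    fun q hq r hr => (h q hq).trans (h r hr).symm⟩

/-! ### The effect of inversion, reversal and complementation -/

theorem mem_image_perm {σ : Perm (Fin n)} {P : Fin n → Prop} [DecidablePred P] {i : Fin n} :
    i ∈ (Finset.univ.filter P).image σ ↔ P (σ⁻¹ i) := by
  simp only [Finset.mem_image, Finset.mem_filter, Finset.mem_univ, true_and]
  constructor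
  · rintro ⟨j, hj, rfl⟩
    simpa using hj
  · exact fun h => ⟨_, h, by simp⟩

theorem inv_apply_apply (σ : Perm (Fin n)) (i : Fin n) : σ⁻¹ (σ i) = i := by
  simp

/-- Inversion transposes the diagram: a point with nothing to its right and below becomes one with
nothing to its left and above. -/
theorem Rmil_eq (σ : Perm (Fin n)) : Rmil σ = Lmap σ⁻¹ := by
  ext i
  obtain ⟨i, rfl⟩ := σ.surjective i
  simp only [Rmil, Lmap, mem_image_perm, Finset.mem_filter, Finset.mem_univ, true_and,
    inv_apply_apply]
  constructor
  · intro h j hj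
    obtain ⟨j, rfl⟩ := σ.surjective j
    rw [inv_apply_apply]
    by_contra! hle
    rcases hle.lt_or_eq with hlt | rfl
    · exact (h _ hlt).not_gt hj
    · exact lt_irrefl _ hj
  · intro h j hj
    by_contra! hle
    rcases hle.lt_or_eq with hlt | he
    · have := h _ hlt
      rw [inv_apply_apply] at this
      exact this.not_gt hj
    · exact hj.ne' (σ.injective he)

theorem Lmil_eq (σ : Perm (Fin n)) : Lmil σ = Lmip σ⁻¹ := by
  ext i
  obtain ⟨i, rfl⟩ := σ.surjective i
  simp only [Lmil, Lmip, mem_image_perm, Finset.mem_filter, Finset.mem_univ, true_and,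
    inv_apply_apply]
  constructor
  · intro h j hj
    obtain ⟨j, rfl⟩ := σ.surjective j
    rw [inv_apply_apply]
    by_contra! hle
    rcases hle.lt_or_eq with hlt | rfl
    · exact (h _ hlt).not_gt hj
    · exact lt_irrefl _ hj
  · intro h j hj
    by_contra! hle
    rcases hle.lt_or_eq with hlt | he
    · have := h _ hlt
      rw [inv_apply_apply] at this
      exact this.not_gt hj
    · exact hj.ne (σ.injective he)

theorem dual_Rmip_eq (σ : Perm (Fin n)) : dual Rmip σ = Lmip (σ * Fin.revPerm) := by
  ext i
  simp only [dual, Rmip, Lmip, Finset.mem_image, Finset.mem_filter, Finset.mem_univ, true_and,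
    Perm.mul_apply, Fin.revPerm_apply]
  constructor
  · rintro ⟨k, hk, rfl⟩ j hj
    simpa using hk j.rev (Fin.lt_rev_iff.mp hj)
  · exact fun h => ⟨i.rev, fun j hj => by simpa using h j.rev (Fin.rev_lt_iff.mp hj), by simp⟩

theorem dual_Rmap_eq (σ : Perm (Fin n)) : dual Rmap σ = Lmap (σ * Fin.revPerm) := by
  ext i
  simp only [dual, Rmap, Lmap, Finset.mem_image, Finset.mem_filter, Finset.mem_univ, true_and,
    Perm.mul_apply, Fin.revPerm_apply]
  constructor
  · rintro ⟨k, hk, rfl⟩ j hj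
    simpa using hk j.rev (Fin.lt_rev_iff.mp hj)
  · exact fun h => ⟨i.rev, fun j hj => by simpa using h j.rev (Fin.rev_lt_iff.mp hj), by simp⟩

theorem Lmip_rev_mul (σ : Perm (Fin n)) : Lmip (Fin.revPerm * σ) = Lmap σ := by
  simp [Lmip, Lmap]

theorem Lmap_rev_mul (σ : Perm (Fin n)) : Lmap (Fin.revPerm * σ) = Lmip σ := by
  simp [Lmip, Lmap]

theorem rev_inv : (Fin.revPerm : Perm (Fin n))⁻¹ = Fin.revPerm := by
  ext i
  simp [Perm.inv_def]

/-- A half-turn of the diagram, conjugation by `Fin.revPerm`, reduces this to `Lmil_eq`. -/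
theorem Rmal_eq (σ : Perm (Fin n)) : Rmal σ = Rmap σ⁻¹ := by
  ext i
  have h := Finset.ext_iff.mp (Lmil_eq (Fin.revPerm * σ * Fin.revPerm)) i.rev
  simp only [Lmil, Lmip, mem_image_perm, Finset.mem_filter, Finset.mem_univ, true_and, mul_inv_rev,
    rev_inv, Perm.mul_apply, Fin.revPerm_apply, Fin.rev_rev, Fin.rev_lt_rev] at h
  simp only [Rmal, Rmap, mem_image_perm, Finset.mem_filter, Finset.mem_univ, true_and]
  refine Iff.trans ?_ (h.trans ?_)
  · exact ⟨fun h j hj => h _ (Fin.lt_rev_iff.mp hj),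
      fun h j hj => by simpa using h j.rev (by simpa using hj)⟩
  · exact ⟨fun h j hj => by simpa using h j.rev (by simpa using hj),
      fun h j hj => h _ (Fin.lt_rev_iff.mp hj)⟩

theorem Lmal_eq (σ : Perm (Fin n)) : Lmal σ = Rmip σ⁻¹ := by
  ext i
  have h := Finset.ext_iff.mp (Rmil_eq (Fin.revPerm * σ * Fin.revPerm)) i.rev
  simp only [Rmil, Lmap, mem_image_perm, Finset.mem_filter, Finset.mem_univ, true_and, mul_inv_rev,
    rev_inv, Perm.mul_apply, Fin.revPerm_apply, Fin.rev_rev, Fin.rev_lt_rev] at h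
  simp only [Lmal, Rmip, mem_image_perm, Finset.mem_filter, Finset.mem_univ, true_and]
  refine Iff.trans ?_ (h.trans ?_)
  · exact ⟨fun h j hj => h _ (Fin.rev_lt_iff.mp hj),
      fun h j hj => by simpa using h j.rev (by simpa using hj)⟩
  · exact ⟨fun h j hj => by simpa using h j.rev (by simpa using hj),
      fun h j hj => h _ (Fin.lt_rev_iff.mp hj)⟩

theorem Cyc_inv (σ : Perm (Fin n)) : Cyc σ⁻¹ = Cyc σ := by
  simp [Cyc, Perm.sameCycle_inv]

/-! ### First return from above and the B-code -/

/-- `FirstReturn τ i j b` says that `b` is the first of `τ j`, `τ (τ j)`, … that is at most `i`. -/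
inductive FirstReturn (τ : Perm (Fin n)) (i : Fin n) : Fin n → Fin n → Prop
  | base {j : Fin n} : τ j ≤ i → FirstReturn τ i j (τ j)
  | step {j b : Fin n} : i < τ j → FirstReturn τ i (τ j) b → FirstReturn τ i j b

theorem FirstReturn.unique {τ : Perm (Fin n)} {i j b c : Fin n} (hb : FirstReturn τ i j b)
    (hc : FirstReturn τ i j c) : b = c := by
  induction hb with
  | base h =>
    cases hc with
    | base _ => rfl
    | step h' _ => exact absurd h h'.not_ge
  | step h _ ih =>
    cases hc with
    | base h' => exact absurd h' h.not_ge
    | step _ h' => exact ih h'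

theorem FirstReturn.of_pow {τ : Perm (Fin n)} {i : Fin n} (k : ℕ) :
    ∀ j, (∀ m, 1 ≤ m → m < k + 1 → i < (τ ^ m) j) → (τ ^ (k + 1)) j ≤ i →
      FirstReturn τ i j ((τ ^ (k + 1)) j) := by
  induction k with
  | zero => exact fun j _ h => by simpa using FirstReturn.base (by simpa using h)
  | succ k ih =>
    intro j hlt hle
    refine .step (by simpa using hlt 1 le_rfl (by omega)) ?_
    rw [pow_succ, Perm.mul_apply] at hle ⊢
    refine ih (τ j) (fun m hm hmk => ?_) hle
    simpa [pow_succ] using hlt (m + 1) (by omega) (by omega)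

/-- Trades the minimal exponent for an inductive predicate, so that later arguments run by induction
along the orbit. -/
theorem firstReturn_bCode (σ : Perm (Fin n)) (i : Fin n) :
    FirstReturn σ⁻¹ i i (bCode σ i) := by
  obtain ⟨h₁, h₂⟩ := Nat.find_spec (exists_back_le σ i)
  have hmin := fun m => Nat.find_min (exists_back_le σ i) (m := m)
  unfold bCode
  generalize Nat.find (exists_back_le σ i) = k at *
  obtain ⟨k, rfl⟩ : ∃ m, k = m + 1 := ⟨k - 1, by omega⟩
  exact .of_pow k i (fun m hm hmk => not_le.mp fun h => hmin m hmk ⟨hm, h⟩) h₂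

theorem bCode_eq_iff {σ : Perm (Fin n)} {i b : Fin n} :
    bCode σ i = b ↔ FirstReturn σ⁻¹ i i b :=
  ⟨fun h => h ▸ firstReturn_bCode σ i, fun h => (firstReturn_bCode σ i).unique h⟩

theorem bCode_le (σ : Perm (Fin n)) (i : Fin n) : bCode σ i ≤ i :=
  (Nat.find_spec (exists_back_le σ i)).2

theorem mem_Cyc_iff {σ : Perm (Fin n)} {i : Fin n} : i ∈ Cyc σ ↔ bCode σ i = i := by
  simp only [Cyc, Finset.mem_filter, Finset.mem_univ, true_and]
  constructor
  · intro h
    refine (bCode_le σ i).antisymm (h _ ?_)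
    rw [← Perm.sameCycle_inv]
    exact ⟨(Nat.find (exists_back_le σ i) : ℤ), by rw [zpow_natCast]; rfl⟩
  · intro h j hj
    rw [bCode_eq_iff] at h
    -- Invariant along the orbit: it stays at or above `i`, and its next visit to `[1, i]` is at `i`
    -- itself, where `h` restarts the excursion.
    have key : ∀ m : ℕ, i ≤ (σ⁻¹ ^ m) i ∧ FirstReturn σ⁻¹ i ((σ⁻¹ ^ m) i) i := by
      intro m
      induction m with
      | zero => exact ⟨le_rfl, h⟩
      | succ m ih =>
        rw [pow_succ', Perm.mul_apply]
        generalize (σ⁻¹ ^ m) i = x at ih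
        obtain ⟨-, hx⟩ := ih
        generalize hb : i = b at hx
        cases hx with
        | base _ => exact hb ▸ ⟨le_rfl, h⟩
        | step h₁ h₂ => subst hb; exact ⟨h₁.le, h₂⟩
    obtain ⟨m, hm⟩ := (Perm.sameCycle_inv.mpr hj).exists_nat_pow_eq
    exact hm ▸ (key m).1

/-! ### Two ways of extending a permutation, with a prescribed last letter -/

/-- The permutation of `[n + 1]` with last letter `l` whose other letters are in the same relative
order as those of `σ`. -/
def insertLetter (l : Fin (n + 1)) (σ : Perm (Fin n)) : Perm (Fin (n + 1)) :=
  finSuccEquivLast.trans ((optionCongr σ).trans (finSuccEquiv' l).symm)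

@[simp] theorem insertLetter_last (l : Fin (n + 1)) (σ : Perm (Fin n)) :
    insertLetter l σ (Fin.last n) = l := by
  simp [insertLetter]

@[simp] theorem insertLetter_castSucc (l : Fin (n + 1)) (σ : Perm (Fin n)) (i : Fin n) :
    insertLetter l σ i.castSucc = l.succAbove (σ i) := by
  simp [insertLetter]

/-- The permutation of `[n + 1]` sending `n + 1` to `l`, from which `σ` results by deleting `n + 1`
from its cycle. -/
def insertCycle (l : Fin (n + 1)) (σ : Perm (Fin n)) : Perm (Fin (n + 1)) :=
  swap (Fin.last n) l * finSuccEquivLast.symm.permCongr (optionCongr σ)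

@[simp] theorem insertCycle_last (l : Fin (n + 1)) (σ : Perm (Fin n)) :
    insertCycle l σ (Fin.last n) = l := by
  simp [insertCycle, permCongr_apply]

theorem insertCycle_castSucc (l : Fin (n + 1)) (σ : Perm (Fin n)) (i : Fin n) :
    insertCycle l σ i.castSucc = if (σ i).castSucc = l then Fin.last n else (σ i).castSucc := by
  simp [insertCycle, permCongr_apply, swap_apply_def, (Fin.castSucc_lt_last _).ne]

theorem insertLetter_bijective :
    Function.Bijective fun x : Fin (n + 1) × Perm (Fin n) => insertLetter x.1 x.2 := by
  rw [Fintype.bijective_iff_injective_and_card]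
  refine ⟨?_, by simp [Fintype.card_perm, Nat.factorial_succ]⟩
  rintro ⟨l, σ⟩ ⟨m, τ⟩ h
  obtain rfl : l = m := by simpa using congrArg (· (Fin.last n)) h
  refine Prod.ext rfl (Equiv.ext fun i => ?_)
  simpa using congrArg (· i.castSucc) h

theorem insertCycle_bijective :
    Function.Bijective fun x : Fin (n + 1) × Perm (Fin n) => insertCycle x.1 x.2 := by
  rw [Fintype.bijective_iff_injective_and_card]
  refine ⟨?_, by simp [Fintype.card_perm, Nat.factorial_succ]⟩
  rintro ⟨l, σ⟩ ⟨m, τ⟩ h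
  obtain rfl : l = m := by simpa using congrArg (· (Fin.last n)) h
  have h := mul_left_cancel h
  exact Prod.ext rfl (optionCongr_injective (Equiv.injective _ h))

/-- Statistics that obey the same recursion along `insertCycle` and along `insertLetter` are
carried to each other by a bijection. -/
theorem exists_equiv_of_recursion {X : ℕ → Type*} (F G : ∀ n, Perm (Fin n) → X n)
    (f : ∀ n, Fin (n + 1) → X n → X (n + 1)) (h₀ : F 0 1 = G 0 1)
    (hF : ∀ n l σ, F (n + 1) (insertCycle l σ) = f n l (F n σ))
    (hG : ∀ n l σ, G (n + 1) (insertLetter l σ) = f n l (G n σ)) (n : ℕ) :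
    ∃ e : Perm (Fin n) ≃ Perm (Fin n), ∀ σ, G n (e σ) = F n σ := by
  induction n with
  | zero => exact ⟨Equiv.refl _, fun σ => by rw [Subsingleton.elim σ 1]; exact h₀.symm⟩
  | succ n ih =>
    obtain ⟨e, he⟩ := ih
    -- Decode by cycles, keep `l`, apply `e` to the smaller permutation, and re-encode by letters.
    refine ⟨(Equiv.ofBijective _ insertCycle_bijective).symm.trans
      (((Equiv.refl _).prodCongr e).trans (Equiv.ofBijective _ insertLetter_bijective)),
      fun σ => ?_⟩
    obtain ⟨⟨l, τ⟩, rfl⟩ := (Equiv.ofBijective _ insertCycle_bijective).surjective σ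
    simp only [Equiv.trans_apply, Equiv.symm_apply_apply]
    simp [hF, hG, he]

/-! ### Recursions for the statistics -/

/-- Adjoin the new largest element if `P` holds. -/
def extendIf (P : Prop) [Decidable P] (A : Finset (Fin n)) : Finset (Fin (n + 1)) :=
  if P then insert (Fin.last n) (A.map Fin.castSuccEmb) else A.map Fin.castSuccEmb

theorem eq_extendIf {P : Prop} [Decidable P] {A : Finset (Fin n)} {B : Finset (Fin (n + 1))}
    (h : Fin.last n ∈ B ↔ P) (h' : ∀ i : Fin n, i.castSucc ∈ B ↔ i ∈ A) : B = extendIf P A := by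
  ext i
  induction i using Fin.lastCases with
  | last => by_cases hP : P <;> simp [extendIf, h, hP]
  | cast i => by_cases hP : P <;> simp [extendIf, h', hP, (Fin.castSucc_lt_last i).ne]

/-- The elements of `A` less than `l`, together with `l`. -/
def truncateAt (l : Fin (n + 1)) (A : Finset (Fin n)) : Finset (Fin (n + 1)) :=
  insert l ((A.map Fin.castSuccEmb).filter (· < l))

theorem Rmil_eq_truncateAt {l : Fin (n + 1)} {σ : Perm (Fin n)} {τ : Perm (Fin (n + 1))}
    (hl : τ (Fin.last n) = l)
    (h : ∀ i : Fin n, (τ i.castSucc = (σ i).castSucc ∧ τ i.castSucc < l) ∨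
      (l ≤ τ i.castSucc ∧ l ≤ (σ i).castSucc)) :
    Rmil τ = truncateAt l (Rmil σ) := by
  -- A letter below `l` beats every letter that is at least `l`, in `σ` and in `τ` alike, so only
  -- the common letters below `l` matter.
  have key : ∀ i : Fin n, τ i.castSucc < l → ((∀ j, i.castSucc < j → τ i.castSucc < τ j) ↔
      ∀ j, i < j → σ i < σ j) := by
    intro i hi
    have e : τ i.castSucc = (σ i).castSucc := (h i).elim And.left fun h => absurd hi h.1.not_gt
    constructor
    · intro H j hj
      have := H j.castSucc (by simpa using hj)
      rw [← Fin.castSucc_lt_castSucc_iff, ← e]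
      rcases h j with ⟨h₁, _⟩ | ⟨_, h₂⟩
      · exact h₁ ▸ this
      · exact hi.trans_le h₂
    · intro H j hj
      induction j using Fin.lastCases with
      | last => rwa [hl]
      | cast j =>
        rcases h j with ⟨h₁, _⟩ | ⟨h₂, _⟩
        · rw [e, h₁, Fin.castSucc_lt_castSucc_iff]
          exact H j (by simpa using hj)
        · exact hi.trans_le h₂
  ext v
  simp only [Rmil, truncateAt, Finset.mem_insert, Finset.mem_filter, Finset.mem_map,
    Finset.mem_image, Finset.mem_univ, true_and, Fin.coe_castSuccEmb]
  constructor
  · rintro ⟨i, hi, rfl⟩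
    induction i using Fin.lastCases with
    | last => exact Or.inl hl
    | cast i =>
      have hlt : τ i.castSucc < l := hl ▸ hi _ (Fin.castSucc_lt_last i)
      have e : τ i.castSucc = (σ i).castSucc := (h i).elim And.left fun h => absurd hlt h.1.not_gt
      exact Or.inr ⟨⟨_, ⟨i, (key i hlt).mp hi, rfl⟩, e.symm⟩, hlt⟩
  · rintro (rfl | ⟨⟨_, ⟨i, hi, rfl⟩, rfl⟩, hlt⟩)
    · exact ⟨Fin.last n, fun j hj => absurd hj (Fin.le_last j).not_gt, hl⟩
    · have e : τ i.castSucc = (σ i).castSucc :=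
        (h i).elim And.left fun h => absurd hlt h.2.not_gt
      exact ⟨i.castSucc, (key i (e ▸ hlt)).mpr hi, e⟩

theorem Rmil_insertLetter (l : Fin (n + 1)) (σ : Perm (Fin n)) :
    Rmil (insertLetter l σ) = truncateAt l (Rmil σ) := by
  refine Rmil_eq_truncateAt (by simp) fun i => ?_
  rw [insertLetter_castSucc]
  rcases lt_or_ge (σ i).castSucc l with h | h
  · rw [Fin.succAbove_of_castSucc_lt _ _ h]
    exact Or.inl ⟨rfl, h⟩
  · rw [Fin.succAbove_of_le_castSucc _ _ h]
    exact Or.inr ⟨h.trans (Fin.castSucc_lt_succ).le, h⟩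

theorem Rmil_insertCycle (l : Fin (n + 1)) (σ : Perm (Fin n)) :
    Rmil (insertCycle l σ) = truncateAt l (Rmil σ) := by
  refine Rmil_eq_truncateAt (by simp) fun i => ?_
  rw [insertCycle_castSucc]
  split_ifs with h
  · exact Or.inr ⟨Fin.le_last l, h.ge⟩
  · rcases lt_or_ge (σ i).castSucc l with h | h
    · exact Or.inl ⟨rfl, h⟩
    · exact Or.inr ⟨h, h⟩

theorem Lmap_insertLetter (l : Fin (n + 1)) (σ : Perm (Fin n)) :
    Lmap (insertLetter l σ) = extendIf (l = Fin.last n) (Lmap σ) := by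
  refine eq_extendIf ?_ fun i => ?_
  · simp only [Lmap, Finset.mem_filter, Finset.mem_univ, true_and, insertLetter_last]
    constructor
    · intro h
      by_contra hl
      -- Otherwise the largest letter stands earlier and blocks the last place.
      obtain ⟨m, hm⟩ := (insertLetter l σ).surjective (Fin.last n)
      have hne : m ≠ Fin.last n := by
        rintro rfl
        exact hl (by simpa using hm)
      have := h m (Fin.lt_last_iff_ne_last.mpr hne)
      exact absurd (hm ▸ this) (Fin.le_last l).not_gt
    · rintro rfl j hj
      refine Fin.lt_last_iff_ne_last.mpr fun h => hj.ne ((insertLetter (Fin.last n) σ).injective ?_)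
      simpa using h
  · simp [Lmap, Fin.forall_fin_succ', (Fin.castSucc_lt_last i).not_gt]

theorem Lmip_insertLetter (l : Fin (n + 1)) (σ : Perm (Fin n)) :
    Lmip (insertLetter l σ) = extendIf (l = 0) (Lmip σ) := by
  refine eq_extendIf ?_ fun i => ?_
  · simp only [Lmip, Finset.mem_filter, Finset.mem_univ, true_and, insertLetter_last]
    constructor
    · intro h
      by_contra hl
      obtain ⟨m, hm⟩ := (insertLetter l σ).surjective 0
      have hne : m ≠ Fin.last n := by
        rintro rfl
        exact hl (by simpa using hm)
      have := h m (Fin.lt_last_iff_ne_last.mpr hne)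
      exact absurd (hm ▸ this) (Fin.zero_le l).not_gt
    · rintro rfl j hj
      refine Fin.pos_iff_ne_zero.mpr fun h => hj.ne ((insertLetter 0 σ).injective ?_)
      simpa using h
  · simp [Lmip, Fin.forall_fin_succ', (Fin.castSucc_lt_last i).not_gt]

/-- The new element exceeds `i`, so a detour through it, made where the orbit would enter `l`,
lengthens the excursion above `i` without changing where it ends. -/
theorem FirstReturn.insertCycle {l : Fin (n + 1)} {τ : Perm (Fin n)} {i j b : Fin n}
    (h : FirstReturn τ i j b) :
    FirstReturn (insertCycle l τ) i.castSucc j.castSucc b.castSucc := by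
  induction h with
  | @base j h =>
    by_cases hl : (τ j).castSucc = l
    · have e : PermStat.insertCycle l τ j.castSucc = Fin.last n := by
        simp [insertCycle_castSucc, hl]
      refine .step (e ▸ Fin.castSucc_lt_last i) ?_
      rw [e, hl]
      have := FirstReturn.base (τ := PermStat.insertCycle l τ) (i := i.castSucc)
        (j := Fin.last n) (by rw [insertCycle_last, ← hl]; simpa using h)
      rwa [insertCycle_last] at this
    · have e : PermStat.insertCycle l τ j.castSucc = (τ j).castSucc := by
        simp [insertCycle_castSucc, hl]
      rw [← e]
      exact .base (by rw [e]; simpa using h)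
  | @step j b h _ ih =>
    by_cases hl : (τ j).castSucc = l
    · have e : PermStat.insertCycle l τ j.castSucc = Fin.last n := by
        simp [insertCycle_castSucc, hl]
      refine .step (e ▸ Fin.castSucc_lt_last i) ?_
      rw [e]
      refine .step (by rw [insertCycle_last, ← hl]; simpa using h) ?_
      rw [hl] at ih
      rwa [insertCycle_last]
    · have e : PermStat.insertCycle l τ j.castSucc = (τ j).castSucc := by
        simp [insertCycle_castSucc, hl]
      exact .step (by rw [e]; simpa using h) (e ▸ ih)

theorem bCode_insertCycle_inv_castSucc (l : Fin (n + 1)) (τ : Perm (Fin n)) (i : Fin n) :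
    bCode (insertCycle l τ)⁻¹ i.castSucc = (bCode τ⁻¹ i).castSucc := by
  have h := firstReturn_bCode τ⁻¹ i
  rw [inv_inv] at h
  rw [bCode_eq_iff, inv_inv]
  exact h.insertCycle

theorem bCode_insertCycle_inv_last (l : Fin (n + 1)) (τ : Perm (Fin n)) :
    bCode (insertCycle l τ)⁻¹ (Fin.last n) = l := by
  rw [bCode_eq_iff, inv_inv]
  have := FirstReturn.base (τ := insertCycle l τ) (j := Fin.last n) (Fin.le_last _)
  rwa [insertCycle_last] at this

theorem Cyc_insertCycle (l : Fin (n + 1)) (σ : Perm (Fin n)) :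
    Cyc (insertCycle l σ) = extendIf (l = Fin.last n) (Cyc σ) := by
  rw [← Cyc_inv, ← Cyc_inv σ]
  refine eq_extendIf ?_ fun i => ?_
  · rw [mem_Cyc_iff, bCode_insertCycle_inv_last]
  · rw [mem_Cyc_iff, mem_Cyc_iff, bCode_insertCycle_inv_castSucc, Fin.castSucc_inj]

theorem Lmic₁_insertCycle_inv (l : Fin (n + 1)) (σ : Perm (Fin n)) :
    Lmic₁ (insertCycle l σ)⁻¹ = extendIf (l = 0) (Lmic₁ σ⁻¹) := by
  refine eq_extendIf ?_ fun i => ?_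
  · simp only [Lmic₁, Finset.mem_filter, Finset.mem_univ, true_and, bCode_insertCycle_inv_last,
      Fin.ext_iff, Fin.val_zero]
  · simp only [Lmic₁, Finset.mem_filter, Finset.mem_univ, true_and,
      bCode_insertCycle_inv_castSucc, Fin.val_castSucc]

/-! ### Comparing cycle statistics with letter statistics -/

theorem equidistributed_Cyc_Rmil (n : ℕ) :
    Equidistributed (n := n) (Cyc, Rmil) (Lmap, Rmil) := by
  obtain ⟨e, he⟩ := exists_equiv_of_recursion
    (X := fun n => Finset (Fin n) × Finset (Fin n))
    (fun n σ => (Cyc σ, Rmil σ)) (fun n σ => (Lmap σ, Rmil σ))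
    (fun n l A => (extendIf (l = Fin.last n) A.1, truncateAt l A.2)) (Subsingleton.elim _ _)
    (fun n l σ => by rw [Cyc_insertCycle, Rmil_insertCycle])
    (fun n l σ => by rw [Lmap_insertLetter, Rmil_insertLetter]) n
  exact equidistributed_of_equiv e (fun σ => congrArg Prod.fst (he σ))
    fun σ => congrArg Prod.snd (he σ)

theorem equidistributed_Cyc_Lmic₁ (n : ℕ) :
    Equidistributed (n := n) (Cyc, Lmic₁) (Lmap, Lmip) := by
  obtain ⟨e, he⟩ := exists_equiv_of_recursion
    (X := fun n => Finset (Fin n) × Finset (Fin n))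
    (fun n σ => (Cyc σ, Lmic₁ σ⁻¹)) (fun n σ => (Lmap σ, Lmip σ))
    (fun n l A => (extendIf (l = Fin.last n) A.1, extendIf (l = 0) A.2)) (Subsingleton.elim _ _)
    (fun n l σ => by rw [Cyc_insertCycle, Lmic₁_insertCycle_inv])
    (fun n l σ => by rw [Lmap_insertLetter, Lmip_insertLetter]) n
  -- The B-code follows preimages whereas `insertCycle` prescribes an image; inverting first
  -- reconciles them, and `Cyc` does not notice.
  refine equidistributed_of_equiv ((Equiv.inv _).trans e)
    (fun σ => (congrArg Prod.fst (he σ⁻¹)).trans (Cyc_inv σ))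
    fun σ => (congrArg Prod.snd (he σ⁻¹)).trans (by rw [inv_inv])

theorem isSymmetric_Rmil_Lmap (n : ℕ) : IsSymmetric (n := n) (Rmil, Lmap) :=
  equidistributed_of_equiv (Equiv.inv _) (fun σ => (Rmil_eq σ).symm)
    fun σ => by simp [Rmil_eq]

theorem isSymmetric_Lmap_Lmip (n : ℕ) : IsSymmetric (n := n) (Lmap, Lmip) :=
  equidistributed_of_equiv (Equiv.mulLeft Fin.revPerm) Lmip_rev_mul Lmap_rev_mul

theorem equidistributed_Cyc_Lmap (n : ℕ) :
    Equidistributed (n := n) (Cyc, Lmap) (Cyc, Rmil) :=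
  equidistributed_of_equiv (Equiv.inv _) Cyc_inv fun σ => by simp [Rmil_eq]

end PermStat

theorem corollary4p3 (n : ℕ) :
    SymmetricAndEquidistributed (n := n)
      [(Rmil, Lmap), (dual Rmip, dual Lmal), (dual Rmal, Lmip), (dual Rmap, Lmil),
        (Cyc, Rmil), (Cyc, Lmap)] ∧
    SymmetricAndEquidistributed (n := n)
      [(Rmil, Lmil), (Lmap, Lmip), (dual Rmip, dual Rmap), (dual Rmal, dual Lmal),
        (Cyc, Lmic₁)] := by
  have dual_Rmal (σ : Equiv.Perm (Fin n)) : dual Rmal σ = dual Rmap σ⁻¹ := by simp [dual, Rmal_eq]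
  have dual_Lmal (σ : Equiv.Perm (Fin n)) : dual Lmal σ = dual Rmip σ⁻¹ := by simp [dual, Lmal_eq]
  have hc : Equidistributed (n := n) (Cyc, Rmil) (Rmil, Lmap) :=
    (equidistributed_Cyc_Rmil n).trans (isSymmetric_Rmil_Lmap n).symm
  constructor
  · refine .of_forall (Rmil, Lmap) (isSymmetric_Rmil_Lmap n) ?_
    simp only [List.forall_mem_cons, List.not_mem_nil, false_implies, implies_true, and_true]
    refine ⟨fun _ _ => rfl, ?_, ?_, ?_, hc, (equidistributed_Cyc_Lmap n).trans hc⟩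
    -- Reflection of the diagram in the antidiagonal; the remaining record pairs likewise use
    -- symmetries of the square.
    · refine equidistributed_of_equiv ((Equiv.inv _).trans
        ((Equiv.mulLeft Fin.revPerm).trans (Equiv.mulRight Fin.revPerm))) (fun σ => ?_) fun σ => ?_
      · simp [Rmil_eq, dual_Rmip_eq, rev_inv, Lmap_rev_mul]
      · simp [dual_Lmal, dual_Rmip_eq, mul_assoc, Lmap_rev_mul]
    · refine equidistributed_of_equiv (Equiv.mulLeft Fin.revPerm) (fun σ => ?_) fun σ => ?_
      · simp [Rmil_eq, dual_Rmal, dual_Rmap_eq, rev_inv]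
      · simp [Lmap_rev_mul]
    · refine equidistributed_of_equiv ((Equiv.inv _).trans (Equiv.mulLeft Fin.revPerm))
        (fun σ => ?_) fun σ => ?_
      · simp [Rmil_eq, dual_Rmap_eq, rev_inv]
      · simp [Lmap_rev_mul, Lmil_eq]
  · refine .of_forall (Lmap, Lmip) (isSymmetric_Lmap_Lmip n) ?_
    simp only [List.forall_mem_cons, List.not_mem_nil, false_implies, implies_true, and_true]
    refine ⟨?_, fun _ _ => rfl, ?_, ?_, equidistributed_Cyc_Lmic₁ n⟩
    · exact equidistributed_of_equiv (Equiv.inv _) (fun σ => (Rmil_eq σ).symm)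
        fun σ => (Lmil_eq σ).symm
    · refine equidistributed_of_equiv ((Equiv.mulRight Fin.revPerm).trans
        (Equiv.mulLeft Fin.revPerm)) (fun σ => ?_) fun σ => ?_
      · simp [dual_Rmip_eq, Lmap_rev_mul]
      · simp [dual_Rmap_eq, Lmip_rev_mul]
    · refine equidistributed_of_equiv ((Equiv.inv _).trans (Equiv.mulRight Fin.revPerm))
        (fun σ => ?_) fun σ => ?_
      · simp [dual_Rmal, dual_Rmap_eq]
      · simp [dual_Lmal, dual_Rmip_eq]
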